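/- **Setting.** Fix an infinite set $V$ of values. A schema is a finite set of relation names, each with an arity, a primary key (a set of attribute positions) and a type, *consistent* or *inconsistent*. An instance assigns to every relation name a finite relation over $V$; relations of consistent type must satisfy their key constraint (two tuples that agree on the key are equal). A repair of an instance $I$ is a maximal subset of $I$ that satisfies all key constraints. For a Boolean conjunctive query (CQ) $Q$, $\mathrm{CERTAINTY}(Q)$ is the problem: given an instance $I$, is $Q$ true in every repair of $I$? Atoms of $Q$ may contain variables, possibly repeated, and constants from $V$. $Q$ is without self-joins if no relation name occurs in two atoms; $Q$ is connected if it has at least one atom and any two atoms are linked by a chain of atoms in which consecutive ones share a variable. $Q$ is *graph-representable* if it is connected, without self-joins, without constants, without repeated variables inside an atom, and all its atoms are binary with exactly one attribute as key. A first-order reduction from $\mathrm{CERTAINTY}(Q)$ to $\mathrm{CERTAINTY}(Q')$ consists of a number $k\ge 1$, a finite set $C\subseteq V$ of constants and, for every relation name $R$ of the schema of $Q'$, of arity $n$, a first-order formula $\varphi_R$ with $kn$ free variables over the vocabulary of the schema of $Q$ with equality and the constants in $C$ (no order or arithmetic). It maps an instance $I$ to the database over $V^k$ whose relation $R$ is the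 set of $n$-tuples of $k$-tuples that satisfy $\varphi_R$ in $I$, where all variables, free and bound, range over $C$ and the values occurring in $I$. It is required that for every instance $I$ for the schema of $Q$ this output is an instance for the schema of $Q'$ and that $Q$ is true in every repair of $I$ if and only if $Q'$ is true in every repair of the output; here a constant $c$ of $Q'$ is read as $(c,\dots,c)\in V^k$. **Theorem.** Let $Q$ be a connected Boolean CQ without self-joins in which the key of each atom consists of either exactly one attribute or all attributes, and in which every atom whose key does not consist of all its attributes has a variable (not a constant) at its key attribute. Then there is a graph-representable query $Q'$ such that there are first-order reductions from $\mathrm{CERTAINTY}(Q)$ to $\mathrm{CERTAINTY}(Q')$ and from $\mathrm{CERTAINTY}(Q')$ to $\mathrm{CERTAINTY}(Q)$. -/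

import Mathlib

open FirstOrder

namespace CQA

universe u v w w'

/-- A database schema: finitely many relation names, each with an arity, a primary key (a set of
attribute positions), and a type, consistent or inconsistent. -/
structure Schema where
  Rel : Type u
  finite_rel : Finite Rel
  arity : Rel → ℕ
  key : (R : Rel) → Set (Fin (arity R))
  consistent : Set Rel

/-- One set of tuples over the value domain `V` for every relation name. The pointwise order of this
function type is inclusion of databases. -/
abbrev Database (S : Schema.{u}) (V : Type w) := (R : S.Rel) → Set (Fin (S.arity R) → V)

section Instances

variable {S : Schema.{u}} {V : Type w}

/-- No two distinct tuples of `R` agree on the key of `R`. -/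
def SatisfiesKey (I : Database S V) (R : S.Rel) : Prop :=
  ∀ s ∈ I R, ∀ t ∈ I R, (∀ i ∈ S.key R, s i = t i) → s = t

/-- Every relation is finite, and those of consistent type satisfy their key constraint. -/
def IsInstance (I : Database S V) : Prop :=
  (∀ R, (I R).Finite) ∧ ∀ R ∈ S.consistent, SatisfiesKey I R

/-- `r` is a maximal subset of `I` among those that satisfy all key constraints. -/
def IsRepair (I r : Database S V) : Prop :=
  Maximal (fun r' : Database S V => r' ≤ I ∧ ∀ R, SatisfiesKey r' R) r

end Instances

/-- An atom `R(t₁, …, tₙ)`; each `tᵢ` is a variable (`Sum.inl`) or a constant (`Sum.inr`). -/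
structure Atom (S : Schema.{u}) (X : Type v) (V : Type w) where
  rel : S.Rel
  args : Fin (S.arity rel) → X ⊕ V

/-- A Boolean conjunctive query: a finite set of atoms, all variables being existentially
quantified. -/
structure BCQ (S : Schema.{u}) (X : Type v) (V : Type w) where
  atoms : Set (Atom S X V)
  finite_atoms : atoms.Finite

/-- Rename the constants of an atom. -/
def Atom.mapConst {S : Schema.{u}} {X : Type v} {V : Type w} {W : Type w'} (f : V → W)
    (a : Atom S X V) : Atom S X W where
  rel := a.rel
  args := fun i => Sum.map id f (a.args i)

/-- The variable `x` occurs in the atom. -/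
def Atom.HasVar {S : Schema.{u}} {X : Type v} {V : Type w} (a : Atom S X V) (x : X) : Prop :=
  ∃ i, a.args i = Sum.inl x

namespace BCQ

variable {S : Schema.{u}} {X : Type v} {V : Type w}

/-- Rename the constants of a query. -/
def mapConst {W : Type w'} (f : V → W) (Q : BCQ S X V) : BCQ S X W where
  atoms := Atom.mapConst f '' Q.atoms
  finite_atoms := Q.finite_atoms.image _

/-- The query is true in the database `r`. -/
def Holds (Q : BCQ S X V) (r : Database S V) : Prop :=
  ∃ ν : X → V, ∀ a ∈ Q.atoms, (fun i => Sum.elim ν id (a.args i)) ∈ r a.rel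

/-- `Q` is certain for `I`: it is true in every repair of `I`. -/
def Certain (Q : BCQ S X V) (I : Database S V) : Prop :=
  ∀ r, IsRepair I r → Q.Holds r

/-- No relation name occurs in two atoms. -/
def SelfJoinFree (Q : BCQ S X V) : Prop := Set.InjOn Atom.rel Q.atoms

/-- There is an atom, and any two atoms are linked by a chain of atoms in which consecutive atoms
share a variable. -/
def Connected (Q : BCQ S X V) : Prop :=
  Q.atoms.Nonempty ∧ ∀ a ∈ Q.atoms, ∀ b ∈ Q.atoms,
    Relation.ReflTransGen
      (fun c d : Atom S X V => d ∈ Q.atoms ∧ ∃ x, c.HasVar x ∧ d.HasVar x) a b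

/-- Connected, without self-joins, without constants, without repeated variables inside an atom,
with binary atoms only, each having exactly one attribute as key. -/
def GraphRepresentable (Q : BCQ S X V) : Prop :=
  Q.Connected ∧ Q.SelfJoinFree ∧
    ∀ a ∈ Q.atoms, S.arity a.rel = 2 ∧ (∃ i, S.key a.rel = {i}) ∧
      (∀ i, ∃ x, a.args i = Sum.inl x) ∧ Function.Injective a.args

end BCQ

/-- The relational first-order vocabulary of a schema (Mathlib's first-order formulas have equality
built in). -/
def Schema.lang (S : Schema.{u}) : FirstOrder.Language.{0, u} where
  Functions := fun _ => Empty
  Relations := fun n => {R : S.Rel // S.arity R = n}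

/-- The values of `I` together with a set `C` of constants: the range of all variables in
the active-domain semantics of first-order queries. -/
def activeDomain {S : Schema.{u}} {V : Type w} (I : Database S V) (C : Finset V) : Set V :=
  {a | a ∈ C ∨ ∃ R, ∃ t ∈ I R, ∃ i, t i = a}

/-- The finite structure that a database presents to first-order formulas with constants `C`. -/
@[reducible] def dbStructure {S : Schema.{u}} {V : Type w} (I : Database S V) (C : Finset V) :
    (S.lang[[C]]).Structure (activeDomain I C) :=
  letI : S.lang.Structure (activeDomain I C) :=
    { funMap := fun f _ => f.elim
      RelMap := fun R t => (fun i => (t (Fin.cast R.2 i) : V)) ∈ I R.1 }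
  letI : (FirstOrder.Language.constantsOn C).Structure (activeDomain I C) :=
    FirstOrder.Language.constantsOn.structure fun c => ⟨c.1, Or.inl c.2⟩
  inferInstance

/-- A first-order query from databases over `S` to databases over `T`: the values of the output are
`dim`-tuples of input values, and every output relation is defined by a first-order formula over
the input, with finitely many constants. -/
structure FOQuery (S : Schema.{u}) (T : Schema.{v}) (V : Type w) where
  dim : ℕ
  dim_pos : 0 < dim
  consts : Finset V
  formula : (R : T.Rel) → (S.lang[[consts]]).Formula (Fin (T.arity R) × Fin dim)

/-- The output database of a first-order query. -/
def FOQuery.eval {S : Schema.{u}} {T : Schema.{v}} {V : Type w} (F : FOQuery S T V)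
    (I : Database S V) : Database T (Fin F.dim → V) :=
  letI := dbStructure I F.consts
  fun R => {t | ∃ e : Fin (T.arity R) × Fin F.dim → activeDomain I F.consts,
    (∀ i j, t i j = e (i, j)) ∧ (F.formula R).Realize e}

/-- There is a first-order many-one reduction from the problem "is `Q` certain for the given
instance" to the same problem for `Q'`. In the output, whose values are tuples, a constant `c`
of `Q'` is represented by the tuple `(c, …, c)`. -/
def FOReducible {S : Schema.{u}} {T : Schema.{v}} {X : Type*} {Y : Type*} {V : Type w}
    (Q : BCQ S X V) (Q' : BCQ T Y V) : Prop :=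
  ∃ F : FOQuery S T V, ∀ I : Database S V, IsInstance I →
    IsInstance (F.eval I) ∧ (Q.Certain I ↔ (Q'.mapConst fun c _ => c).Certain (F.eval I))

/-- First-order reductions in both directions. -/
def FOInterReducible {S : Schema.{u}} {T : Schema.{v}} {X : Type*} {Y : Type*} {V : Type w}
    (Q : BCQ S X V) (Q' : BCQ T Y V) : Prop :=
  FOReducible Q Q' ∧ FOReducible Q' Q

end CQA

namespace CQA

universe u v w w'

/-! Tuples are given identifiers. An atom of `Q` becomes one binary atom from its key to a tuple
identifier, and one binary atom of consistent type from the identifier to the value at each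
position. A constant of `Q` is replaced by a variable of its own, and the data enforces it instead.
All inconsistency then sits in the key-to-identifier relations, where choosing a tuple of a block
means choosing an identifier. Repairs are block choices (`isRepair_iff_isBlockChoice`), so certainty
becomes a `CertainFamily` statement, and both reductions are maps of facts that respect blocks, to
which `certainFamily_iff_of_map` applies.

From `Q` to the graph query, the identifier is the tuple itself, padded to a uniform length. From
the graph query to `Q`, the position relations are read to recover the tuple named by an identifier.
The obstacle is a fact whose identifier names no tuple: a repair may choose it and falsify the
query. It is simulated by a tuple with the same key and fresh tags elsewhere. This tuple cannot
match if some position outside the key holds a constant or a variable with a second occurrence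
(`graphPattern_iff_pattern`).

If no such position exists, the atom is `Free`: it constrains its key variable only, so the choice
within a block is irrelevant and its graph relation may be declared consistent. An unreadable fact
of a consistent relation is a whole block without matches and is dropped. Conversely, `keep`
collapses each block of a free atom to one fact, so that the first reduction respects this
declaration. -/

/-! ### Block choices and transport of certainty -/

/-- `r` selects exactly one element of every block of `B`, the blocks being the fibres of `k`. -/
def IsBlockChoice {F K : Type*} (k : F → K) (B r : Set F) : Prop :=
  r ⊆ B ∧ Set.InjOn k r ∧ ∀ s ∈ B, ∃ t ∈ r, k t = k s

/-- Every choice of one element per block, in every set of the family, contains a matching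
selection. -/
def CertainFamily {A : Type*} {F K : A → Type*} (k : ∀ a, F a → K a) (B : ∀ a, Set (F a))
    (M : (∀ a, F a) → Prop) : Prop :=
  ∀ r : ∀ a, Set (F a), (∀ a, IsBlockChoice (k a) (B a) (r a)) → ∃ f, (∀ a, f a ∈ r a) ∧ M f

/-- A block choice may be taken inside `M` in all blocks that meet `M`. -/
theorem exists_isBlockChoice {F K : Type*} (k : F → K) (B M : Set F) :
    ∃ r, IsBlockChoice k B r ∧ ∀ s ∈ r, ∀ t ∈ B, t ∈ M → k s = k t → s ∈ M := by
  have h : ∀ c : k '' B, ∃ t ∈ B, k t = c ∧ ((∃ t' ∈ B, t' ∈ M ∧ k t' = c) → t ∈ M) := by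
    rintro ⟨_, s, hs, rfl⟩
    by_cases h : ∃ t' ∈ B, t' ∈ M ∧ k t' = k s
    · obtain ⟨t, ht, htM, hk⟩ := h
      exact ⟨t, ht, hk, fun _ => htM⟩
    · exact ⟨s, hs, rfl, fun h' => absurd h' h⟩
  choose g hgB hgk hgM using h
  refine ⟨Set.range g, ⟨?_, ?_, ?_⟩, ?_⟩
  · rintro _ ⟨c, rfl⟩
    exact hgB c
  · rintro _ ⟨c, rfl⟩ _ ⟨d, rfl⟩ h
    rw [hgk, hgk] at h
    rw [Subtype.ext h]
  · intro s hs
    exact ⟨_, ⟨⟨k s, s, hs, rfl⟩, rfl⟩, hgk _⟩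
  · rintro _ ⟨c, rfl⟩ t ht htM hk
    exact hgM c ⟨t, ht, htM, by rw [← hk, hgk]⟩

/-- Transport of certainty along maps `φ` of facts that respect blocks; `D` consists of whole
blocks of facts that never match. -/
theorem certainFamily_iff_of_map {A : Type*} {F K F' K' : A → Type*} {k : ∀ a, F a → K a}
    {k' : ∀ a, F' a → K' a} {B : ∀ a, Set (F a)} {B' : ∀ a, Set (F' a)}
    {M : (∀ a, F a) → Prop} {M' : (∀ a, F' a) → Prop} (φ : ∀ a, F a → F' a)
    (D : ∀ a, Set (F a)) (hB : ∀ a, B' a = φ a '' (B a \ D a))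
    (hk : ∀ a, ∀ s ∈ B a \ D a, ∀ t ∈ B a \ D a, k a s = k a t → k' a (φ a s) = k' a (φ a t))
    (hk' : ∀ a, ∀ s ∈ B a \ D a, ∀ t ∈ B a \ D a, k' a (φ a s) = k' a (φ a t) →
      k a s = k a t ∨ φ a s = φ a t)
    (hD : ∀ a, ∀ s ∈ B a, ∀ t ∈ B a, k a s = k a t → s ∈ D a → t ∈ D a)
    (hM : ∀ f : ∀ a, F a, (∀ a, f a ∈ B a) →
      (M f ↔ (∀ a, f a ∉ D a) ∧ M' (fun a => φ a (f a)))) :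
    CertainFamily k B M ↔ CertainFamily k' B' M' := by
  constructor
  · intro h r' hr'
    -- In every block containing a preimage of a member of `r'`, such a preimage is chosen, so that
    -- a match found in `r` maps into `r'`.
    choose r hr hrM using fun a => exists_isBlockChoice (k a) (B a) {t | t ∉ D a ∧ φ a t ∈ r' a}
    obtain ⟨f, hf, hfM⟩ := h r hr
    have hfB : ∀ a, f a ∈ B a := fun a => (hr a).1 (hf a)
    obtain ⟨hfD, hfM'⟩ := (hM f hfB).1 hfM
    refine ⟨_, fun a => ?_, hfM'⟩
    have hmem : φ a (f a) ∈ B' a := by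
      rw [hB]
      exact ⟨_, ⟨hfB a, hfD a⟩, rfl⟩
    obtain ⟨s', hs', hk1⟩ := (hr' a).2.2 _ hmem
    have hs'B := (hr' a).1 hs'
    rw [hB] at hs'B
    obtain ⟨s, hs, rfl⟩ := hs'B
    -- Distinct blocks may merge only where their images coincide, as happens when several
    -- identifiers name one tuple of a relation whose key is everything.
    rcases hk' a s hs _ ⟨hfB a, hfD a⟩ hk1 with h1 | h1
    · exact (hrM a _ (hf a) s hs.1 ⟨hs.2, hs'⟩ h1.symm).2
    · exact h1 ▸ hs'
  · intro h r hr
    obtain ⟨f', hf', hfM'⟩ := h (fun a => φ a '' (r a \ D a)) fun a => by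
      refine ⟨?_, ?_, ?_⟩
      · rw [hB]
        exact Set.image_mono (Set.sdiff_subset_sdiff_left (hr a).1)
      · rintro _ ⟨s, hs, rfl⟩ _ ⟨t, ht, rfl⟩ hst
        rcases hk' a s ⟨(hr a).1 hs.1, hs.2⟩ t ⟨(hr a).1 ht.1, ht.2⟩ hst with h1 | h1
        · rw [(hr a).2.1 hs.1 ht.1 h1]
        · exact h1
      · intro s' hs'
        rw [hB] at hs'
        obtain ⟨s, hs, rfl⟩ := hs'
        obtain ⟨t, ht, hts⟩ := (hr a).2.2 s hs.1
        have htD : t ∉ D a := fun h' => hs.2 (hD a t ((hr a).1 ht) s hs.1 hts h')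
        exact ⟨_, ⟨t, ⟨ht, htD⟩, rfl⟩, hk a t ⟨(hr a).1 ht, htD⟩ s hs hts⟩
    choose f hf hff using hf'
    refine ⟨f, fun a => (hf a).1, (hM f fun a => (hr a).1 (hf a).1).2 ⟨fun a => (hf a).2, ?_⟩⟩
    rwa [show (fun a => φ a (f a)) = f' from funext hff]

/-! ### Repairs as block choices -/

section Repairs

variable {S : Schema.{u}} {V : Type w}

/-- The values of a tuple at the key of its relation. -/
def keyPart (R : S.Rel) (t : Fin (S.arity R) → V) : S.key R → V := fun i => t i

theorem keyPart_eq_iff {R : S.Rel} {s t : Fin (S.arity R) → V} :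
    keyPart R s = keyPart R t ↔ ∀ i ∈ S.key R, s i = t i :=
  ⟨fun h i hi => congrFun h ⟨i, hi⟩, fun h => funext fun i => h i i.2⟩

theorem satisfiesKey_iff_injOn {I : Database S V} {R : S.Rel} :
    SatisfiesKey I R ↔ Set.InjOn (keyPart R) (I R) := by
  simp only [SatisfiesKey, Set.InjOn, keyPart_eq_iff]

/-- A tuple from a block that `r` misses could be added without violating a key; conversely, once
every block is met, any further tuple violates one. -/
theorem isRepair_iff_isBlockChoice {I r : Database S V} :
    IsRepair I r ↔ ∀ R, IsBlockChoice (keyPart R) (I R) (r R) := by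
  classical
  simp only [IsRepair, satisfiesKey_iff_injOn]
  constructor
  · intro h R
    refine ⟨h.prop.1 R, h.prop.2 R, fun s hs => ?_⟩
    by_contra! hno
    have hle : r ≤ Function.update r R (insert s (r R)) := by
      intro R'
      by_cases hR : R' = R
      · subst hR
        simp
      · simp [hR]
    have := h.le_of_ge (y := Function.update r R (insert s (r R))) ⟨?_, ?_⟩ hle R
    · rw [Function.update_self] at this
      exact hno s (this (Set.mem_insert _ _)) rfl
    · intro R'
      by_cases hR : R' = R
      · subst hR
        rw [Function.update_self]
        exact Set.insert_subset hs (h.prop.1 R')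
      · simpa [hR] using h.prop.1 R'
    · intro R'
      by_cases hR : R' = R
      · subst hR
        rw [Function.update_self]
        refine (Set.injOn_insert fun h' => hno s h' rfl).2 ⟨h.prop.2 R', ?_⟩
        rintro ⟨t, ht, hts⟩
        exact hno t ht hts
      · simpa [hR] using h.prop.2 R'
  · intro h
    refine ⟨⟨fun R => (h R).1, fun R => (h R).2.1⟩, fun r' hr' hle R t ht => ?_⟩
    obtain ⟨s, hs, hst⟩ := (h R).2.2 t (hr'.1 R ht)
    rwa [← hr'.2 R (hle R hs) ht hst]

theorem IsBlockChoice.eq_of_injOn {F K : Type*} {k : F → K} {B r : Set F}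
    (h : IsBlockChoice k B r) (hB : Set.InjOn k B) : r = B := by
  refine h.1.antisymm fun s hs => ?_
  obtain ⟨t, ht, hts⟩ := h.2.2 s hs
  rwa [← hB (h.1 ht) hs hts]

/-- The tuple that a valuation assigns to an atom. -/
def Atom.tuple {X : Type v} (q : Atom S X V) (ν : X → V) : Fin (S.arity q.rel) → V :=
  fun i => Sum.elim ν id (q.args i)

/-- Certainty in terms of block choices in the relations of a self-join-free set of atoms that
contains all atoms whose relations violate their keys. -/
theorem certain_iff_certainFamily {X : Type v} {A : Type*} (Q : BCQ S X V) (I : Database S V)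
    (q : A → Atom S X V) (hinj : Function.Injective fun a => (q a).rel)
    (hq : ∀ a, q a ∈ Q.atoms)
    (hcov : ∀ p ∈ Q.atoms, (∃ a, q a = p) ∨ SatisfiesKey I p.rel) :
    Q.Certain I ↔ CertainFamily (fun a => keyPart (q a).rel) (fun a => I (q a).rel)
      (fun f => ∃ ν : X → V, (∀ a, f a = (q a).tuple ν) ∧
        ∀ p ∈ Q.atoms, p.tuple ν ∈ I p.rel) := by
  constructor
  · intro h r hr
    -- The given choices are imposed on a repair of the whole database. Equality of dependent pairs
    -- avoids transport along `(q a).rel = R`.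
    choose r' hr' hr'M using fun R => exists_isBlockChoice (keyPart R) (I R)
      {t | ∃ a, ∃ s ∈ r a, (⟨(q a).rel, s⟩ : (R : S.Rel) × (Fin (S.arity R) → V)) = ⟨R, t⟩}
    obtain ⟨ν, hν⟩ := h r' (isRepair_iff_isBlockChoice.2 hr')
    refine ⟨fun a => (q a).tuple ν, fun a => ?_, ν, fun _ => rfl, fun p hp => (hr' _).1 (hν p hp)⟩
    have hm : (q a).tuple ν ∈ r' (q a).rel := hν _ (hq a)
    obtain ⟨t, ht, htk⟩ := (hr a).2.2 _ ((hr' _).1 hm)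
    obtain ⟨b, s, hs, hbs⟩ := hr'M _ _ hm t ((hr a).1 ht) ⟨a, t, ht, rfl⟩ htk.symm
    obtain rfl : b = a := hinj (congrArg Sigma.fst hbs)
    simp only [Sigma.mk.injEq, heq_eq_eq, true_and] at hbs
    change (q b).tuple ν ∈ r b
    rwa [← hbs]
  · intro h r hr
    rw [isRepair_iff_isBlockChoice] at hr
    obtain ⟨f, hf, ν, hfν, hν⟩ := h (fun a => r (q a).rel) fun a => hr _
    refine ⟨ν, fun p hp => ?_⟩
    rcases hcov p hp with ⟨a, rfl⟩ | hk
    · have := hf a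
      rwa [hfν a] at this
    · rw [(hr p.rel).eq_of_injOn (satisfiesKey_iff_injOn.1 hk)]
      exact hν p hp

end Repairs

/-! ### First-order definability over the active domain -/

section Expressible

variable {S : Schema.{u}} {V : Type w} {C : Finset V} {α β : Type*}

attribute [local instance] dbStructure

/-- The relation name `R` as a symbol of the vocabulary with constants. -/
def Schema.symbol (C : Finset V) (R : S.Rel) : (S.lang[[C]]).Relations (S.arity R) :=
  Sum.inl ⟨R, rfl⟩

/-- The predicate `P` on assignments of values of the active domain is defined by a first-order
formula, uniformly in the database. -/
def Expressible (C : Finset V) (P : Database S V → (α → V) → Prop) : Prop :=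
  ∃ φ : (S.lang[[C]]).Formula α, ∀ (I : Database S V) (e : α → activeDomain I C),
    φ.Realize e ↔ P I fun i => e i

namespace Expressible

variable {P Q : Database S V → (α → V) → Prop}

theorem congr (hP : Expressible C P)
    (h : ∀ I e, (∀ i, e i ∈ activeDomain I C) → (P I e ↔ Q I e)) : Expressible C Q := by
  obtain ⟨φ, hφ⟩ := hP
  exact ⟨φ, fun I e => (hφ I e).trans (h I _ fun i => (e i).2)⟩

theorem eq (i j : α) : Expressible (S := S) C fun _ e => e i = e j := by
  refine ⟨Language.Term.equal (Language.Term.var i) (Language.Term.var j), fun I e => ?_⟩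
  simp [Language.Formula.realize_equal, Subtype.ext_iff]

theorem eq_const (i : α) {c : V} (hc : c ∈ C) :
    Expressible (S := S) C fun _ e => e i = c := by
  refine ⟨Language.Term.equal (Language.Term.var i)
    (Language.Constants.term (S.lang.con (⟨c, hc⟩ : C))), fun I e => ?_⟩
  rw [Language.Formula.realize_equal, Language.Term.realize_constants, Subtype.ext_iff]
  rfl

theorem mem (R : S.Rel) (g : Fin (S.arity R) → α) :
    Expressible C fun I e => (fun i => e (g i)) ∈ I R := by
  refine ⟨(Schema.symbol C R).formula fun i => Language.Term.var (g i),
    fun I e => ?_⟩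
  rw [Language.Formula.realize_rel]
  rfl

theorem not (hP : Expressible C P) : Expressible C fun I e => ¬ P I e := by
  obtain ⟨φ, hφ⟩ := hP
  exact ⟨φ.not, fun I e => by rw [Language.Formula.realize_not, hφ]⟩

theorem and (hP : Expressible C P) (hQ : Expressible C Q) :
    Expressible C fun I e => P I e ∧ Q I e := by
  obtain ⟨φ, hφ⟩ := hP
  obtain ⟨ψ, hψ⟩ := hQ
  exact ⟨φ ⊓ ψ, fun I e => by rw [Language.Formula.realize_inf, hφ, hψ]⟩

theorem or (hP : Expressible C P) (hQ : Expressible C Q) :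
    Expressible C fun I e => P I e ∨ Q I e := by
  obtain ⟨φ, hφ⟩ := hP
  obtain ⟨ψ, hψ⟩ := hQ
  exact ⟨φ ⊔ ψ, fun I e => by rw [Language.Formula.realize_sup, hφ, hψ]⟩

theorem forall_finite {ι : Type*} [Finite ι] {P : ι → Database S V → (α → V) → Prop}
    (hP : ∀ i, Expressible C (P i)) : Expressible C fun I e => ∀ i, P i I e := by
  choose φ hφ using hP
  exact ⟨Language.Formula.iInf φ, fun I e => by
    rw [Language.Formula.realize_iInf]
    exact forall_congr' fun i => hφ i I e⟩

theorem const (p : Prop) : Expressible (S := S) (α := α) C fun _ _ => p := by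
  by_cases hp : p
  · exact ⟨⊤, fun I e => by simp [hp]⟩
  · exact ⟨⊥, fun I e => by simp [hp]⟩

/-- Serves side conditions that depend on the query alone, where a formula is needed only if the
condition holds. -/
theorem imp_const (p : Prop) (hP : p → Expressible C P) :
    Expressible C fun I e => p → P I e := by
  by_cases hp : p
  · exact (hP hp).congr fun _ _ _ => by simp [hp]
  · exact (const True).congr fun _ _ _ => by simp [hp]

/-- Quantification over finitely many values which the predicate forces into the active domain. -/
theorem exists_tuple [Finite β] {P : Database S V → (α → V) → (β → V) → Prop}
    (hP : Expressible C fun I (e : α ⊕ β → V) => P I (e ∘ Sum.inl) (e ∘ Sum.inr))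
    (hdom : ∀ I e g, P I e g → ∀ j, g j ∈ activeDomain I C) :
    Expressible C fun I e => ∃ g : β → V, P I e g := by
  obtain ⟨φ, hφ⟩ := hP
  refine ⟨φ.iExs β, fun I e => ?_⟩
  rw [Language.Formula.realize_iExs]
  constructor
  · rintro ⟨g, hg⟩
    exact ⟨_, (hφ I _).1 hg⟩
  · rintro ⟨g, hg⟩
    exact ⟨fun j => ⟨g j, hdom I _ g hg j⟩, (hφ I _).2 hg⟩

end Expressible

theorem mem_activeDomain {I : Database S V} {R : S.Rel} {t : Fin (S.arity R) → V} (ht : t ∈ I R)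
    (i : Fin (S.arity R)) : t i ∈ activeDomain I C :=
  Or.inr ⟨R, t, ht, i, rfl⟩

/-- Expressible output relations over the active domain constitute a first-order query. -/
theorem exists_foQuery {T : Schema.{v}} {k : ℕ} (hk : 0 < k) (C : Finset V)
    (out : Database S V → Database T (Fin k → V))
    (hdom : ∀ I R, ∀ t ∈ out I R, ∀ i j, t i j ∈ activeDomain I C)
    (hout : ∀ R, Expressible C fun I (e : Fin (T.arity R) × Fin k → V) =>
      (fun i j => e (i, j)) ∈ out I R) :
    ∃ F : FOQuery S T V, ∃ h : F.dim = k, ∀ I, h ▸ F.eval I = out I := by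
  choose φ hφ using hout
  refine ⟨⟨k, hk, C, φ⟩, rfl, fun I => funext fun R => Set.ext fun t => ?_⟩
  constructor
  · rintro ⟨e, he, hr⟩
    rw [show t = fun i j => (e (i, j) : V) from funext fun i => funext fun j => he i j]
    exact (hφ R I e).1 hr
  · intro ht
    exact ⟨fun p => ⟨t p.1 p.2, hdom I R t ht _ _⟩, fun _ _ => rfl, (hφ R I _).2 ht⟩

theorem foReducible_of_expressible {T : Schema.{v}} {X Y : Type*} {Q : BCQ S X V} {Q' : BCQ T Y V}
    {k : ℕ} (hk : 0 < k) (C : Finset V) (out : Database S V → Database T (Fin k → V))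
    (hdom : ∀ I R, ∀ t ∈ out I R, ∀ i j, t i j ∈ activeDomain I C)
    (hout : ∀ R, Expressible C fun I (e : Fin (T.arity R) × Fin k → V) =>
      (fun i j => e (i, j)) ∈ out I R)
    (h : ∀ I, IsInstance I → IsInstance (out I) ∧
      (Q.Certain I ↔ (Q'.mapConst fun c _ => c).Certain (out I))) :
    FOReducible Q Q' := by
  obtain ⟨F, rfl, hF⟩ := exists_foQuery hk C out hdom hout
  refine ⟨F, fun I hI => ?_⟩
  rw [show F.eval I = out I from hF I]
  exact h I hI

end Expressible

theorem certainFamily_congr {A : Type*} {F K : A → Type*} {k : ∀ a, F a → K a}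
    {B : ∀ a, Set (F a)} {M M' : (∀ a, F a) → Prop}
    (h : ∀ f : ∀ a, F a, (∀ a, f a ∈ B a) → (M f ↔ M' f)) :
    CertainFamily k B M ↔ CertainFamily k B M' :=
  forall₂_congr fun _ hr => exists_congr fun _ =>
    and_congr_right fun hf => h _ fun a => (hr a).1 (hf a)

theorem BCQ.mapConst_id {S : Schema.{u}} {X : Type v} {V : Type w} (Q : BCQ S X V) :
    Q.mapConst id = Q := by
  have : Atom.mapConst (S := S) (X := X) (id : V → V) = id := by
    funext a
    simp [Atom.mapConst]
  cases Q
  simp [BCQ.mapConst, this]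

/-! ### The graph query -/

/-- Atoms with distinct relation names, each with a key that consists of a single position
`keyPos a = some i`, which holds a variable, or of all positions, where `keyPos a = none`. -/
structure SimpleKeyFamily (S : Schema.{u}) (X : Type v) (V : Type w) (N : ℕ) where
  atom : Fin N → Atom S X V
  rel_injective : Function.Injective fun a => (atom a).rel
  keyPos : ∀ a, Option (Fin (S.arity (atom a).rel))
  key_of_none : ∀ a, keyPos a = none → S.key (atom a).rel = Set.univ
  key_of_some : ∀ a i, keyPos a = some i → S.key (atom a).rel = {i}
  var_of_some : ∀ a i, keyPos a = some i → ∃ x, (atom a).args i = Sum.inl x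

namespace SimpleKeyFamily

variable {S : Schema.{u}} {X : Type v} {V : Type w} {N : ℕ} (G : SimpleKeyFamily S X V N)

/-- Tuples of the relation of the atom `a`. -/
abbrev Tuple (a : Fin N) (W : Type*) := Fin (S.arity (G.atom a).rel) → W

/-- The argument positions of all atoms. -/
abbrev Pos := (a : Fin N) × Fin (S.arity (G.atom a).rel)

/-- The term at a position. -/
def term (p : G.Pos) : X ⊕ V := (G.atom p.1).args p.2

/-- The positions are equal or hold the same variable. -/
def SameVar (p p' : G.Pos) : Prop :=
  p = p' ∨ ∃ x, G.term p = Sum.inl x ∧ G.term p' = Sum.inl x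

/-- Positions up to equality of their variables. -/
def posSetoid : Setoid G.Pos where
  r := G.SameVar
  iseqv :=
    { refl := fun _ => Or.inl rfl
      symm := by
        rintro p p' (rfl | ⟨x, h, h'⟩)
        · exact Or.inl rfl
        · exact Or.inr ⟨x, h', h⟩
      trans := by
        rintro p p' p'' (rfl | ⟨x, h, h'⟩) hp
        · exact hp
        · rcases hp with rfl | ⟨y, hy, hy'⟩
          · exact Or.inr ⟨x, h, h'⟩
          · rw [h'] at hy
            exact Or.inr ⟨x, h, by rw [hy', Sum.inl.inj hy]⟩ }

/-- The tuples match the terms of the atoms. -/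
def Pattern {W : Type*} (emb : V → W) (f : ∀ a, G.Tuple a W) : Prop :=
  (∀ p c, G.term p = Sum.inr c → f p.1 p.2 = emb c) ∧
    ∀ p p', G.SameVar p p' → f p.1 p.2 = f p'.1 p'.2

/-- Every position outside the key holds a variable without another occurrence, so that the atom
constrains its key variable only. -/
def Free (a : Fin N) : Prop :=
  ∃ i, G.keyPos a = some i ∧ ∀ j, j ≠ i →
    (∀ p, G.SameVar ⟨a, j⟩ p → p = ⟨a, j⟩) ∧ ∃ x, G.term ⟨a, j⟩ = Sum.inl x

/-- The key constraint of the atom may be assumed to hold. -/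
def Consistent (a : Fin N) : Prop :=
  G.keyPos a = none ∨ (G.atom a).rel ∈ S.consistent ∨ G.Free a

/-- The schema with a binary relation from keys to tuple identifiers for every atom, and a binary
relation from tuple identifiers to values for every position. -/
@[reducible] def graphSchema : Schema.{0} where
  Rel := Fin N ⊕ G.Pos
  finite_rel := inferInstance
  arity _ := 2
  key _ := {0}
  consistent := {R | ∀ a, R = Sum.inl a → G.Consistent a}

/-- The variables of the graph query: those of the given atoms, a tuple identifier for every
atom, and an additional variable for every atom. -/
abbrev GraphVar := Quotient G.posSetoid ⊕ (Fin N ⊕ Fin N)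

/-- The variable at a position. -/
def posVar (p : G.Pos) : G.GraphVar := Sum.inl (Quotient.mk G.posSetoid p)

/-- The variable of the tuple identifier of an atom. -/
def idVar (a : Fin N) : G.GraphVar := Sum.inr (Sum.inl a)

/-- The variable for the key of an atom. -/
def keyVar (a : Fin N) : G.GraphVar :=
  (G.keyPos a).elim (Sum.inr (Sum.inr a)) fun i => G.posVar ⟨a, i⟩

/-- The atoms of the graph query. -/
def graphAtom : Fin N ⊕ G.Pos → Atom G.graphSchema G.GraphVar V
  | Sum.inl a => ⟨Sum.inl a, ![Sum.inl (G.keyVar a), Sum.inl (G.idVar a)]⟩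
  | Sum.inr p => ⟨Sum.inr p, ![Sum.inl (G.idVar p.1), Sum.inl (G.posVar p)]⟩

/-- The graph query of a family of atoms. -/
def graphQuery : BCQ G.graphSchema G.GraphVar V where
  atoms := Set.range G.graphAtom
  finite_atoms := Set.finite_range _

theorem graphAtom_rel (R : Fin N ⊕ G.Pos) : (G.graphAtom R).rel = R := by
  cases R <;> rfl

theorem keyVar_ne_idVar (a b : Fin N) : G.keyVar a ≠ G.idVar b := by
  unfold keyVar idVar posVar
  cases G.keyPos a <;> simp

theorem idVar_ne_posVar (a : Fin N) (p : G.Pos) : G.idVar a ≠ G.posVar p := by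
  simp [idVar, posVar]

/-- The identifier variable links the key atom to the position atoms of the same original atom, and
a variable shared by two original atoms is shared by two position atoms. One link in `Q` thus
becomes a path of three links. -/
theorem graphQuery_connected (Q : BCQ S X V) (hQ : Q.atoms = Set.range G.atom)
    (hconn : Q.Connected) : G.graphQuery.Connected := by
  have h1 : ∀ p : G.Pos, (∃ x, (G.graphAtom (Sum.inl p.1)).HasVar x ∧
      (G.graphAtom (Sum.inr p)).HasVar x) := fun p => ⟨G.idVar p.1, ⟨1, rfl⟩, ⟨0, rfl⟩⟩
  have h1' : ∀ p : G.Pos, (∃ x, (G.graphAtom (Sum.inr p)).HasVar x ∧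
      (G.graphAtom (Sum.inl p.1)).HasVar x) := fun p => ⟨G.idVar p.1, ⟨0, rfl⟩, ⟨1, rfl⟩⟩
  have hmem : ∀ R, G.graphAtom R ∈ G.graphQuery.atoms := fun R => ⟨R, rfl⟩
  obtain ⟨⟨c, hc⟩, hch⟩ := hconn
  rw [hQ] at hc
  obtain ⟨a0, rfl⟩ := hc
  refine ⟨⟨_, hmem (Sum.inl a0)⟩, ?_⟩
  have key : ∀ a b, Relation.ReflTransGen (fun c d : Atom G.graphSchema G.GraphVar V =>
      d ∈ G.graphQuery.atoms ∧ ∃ x, c.HasVar x ∧ d.HasVar x)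
      (G.graphAtom (Sum.inl a)) (G.graphAtom (Sum.inl b)) := by
    intro a b
    have hab := hch (G.atom a) (hQ ▸ ⟨a, rfl⟩) (G.atom b) (hQ ▸ ⟨b, rfl⟩)
    have hinj : Function.Injective G.atom := fun a b h => G.rel_injective (congrArg Atom.rel h)
    have gen : ∀ d, Relation.ReflTransGen (fun c d : Atom S X V =>
        d ∈ Q.atoms ∧ ∃ x, c.HasVar x ∧ d.HasVar x) (G.atom a) d → ∀ b, G.atom b = d →
        Relation.ReflTransGen (fun c d : Atom G.graphSchema G.GraphVar V =>
          d ∈ G.graphQuery.atoms ∧ ∃ x, c.HasVar x ∧ d.HasVar x)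
          (G.graphAtom (Sum.inl a)) (G.graphAtom (Sum.inl b)) := by
      intro d hd
      induction hd with
      | refl =>
        intro b hb
        rw [hinj hb]
      | @tail c d hac hcd ih =>
        rintro b rfl
        have hc : c ∈ Set.range G.atom := by
          rcases Relation.ReflTransGen.cases_tail hac with rfl | ⟨e, _, he⟩
          · exact ⟨a, rfl⟩
          · exact hQ ▸ he.1
        obtain ⟨c, rfl⟩ := hc
        obtain ⟨x, ⟨i, hi⟩, j, hj⟩ := hcd.2
        refine (((ih c rfl).tail ⟨hmem (Sum.inr ⟨c, i⟩), h1 ⟨c, i⟩⟩).tail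
          ⟨hmem (Sum.inr ⟨b, j⟩), G.posVar ⟨c, i⟩, ⟨1, rfl⟩, 1, ?_⟩).tail
          ⟨hmem (Sum.inl b), h1' ⟨b, j⟩⟩
        have : G.posVar ⟨c, i⟩ = G.posVar ⟨b, j⟩ :=
          congrArg Sum.inl (Quotient.sound (s := G.posSetoid) (Or.inr ⟨x, hi, hj⟩))
        rw [this]
        rfl
    exact gen _ hab b rfl
  have left : ∀ R, ∃ a, Relation.ReflTransGen (fun c d : Atom G.graphSchema G.GraphVar V =>
      d ∈ G.graphQuery.atoms ∧ ∃ x, c.HasVar x ∧ d.HasVar x)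
      (G.graphAtom R) (G.graphAtom (Sum.inl a)) := by
    rintro (a | p)
    · exact ⟨a, .refl⟩
    · exact ⟨p.1, .single ⟨hmem _, h1' p⟩⟩
  have right : ∀ R, ∃ a, Relation.ReflTransGen (fun c d : Atom G.graphSchema G.GraphVar V =>
      d ∈ G.graphQuery.atoms ∧ ∃ x, c.HasVar x ∧ d.HasVar x)
      (G.graphAtom (Sum.inl a)) (G.graphAtom R) := by
    rintro (a | p)
    · exact ⟨a, .refl⟩
    · exact ⟨p.1, .single ⟨hmem _, h1 p⟩⟩
  rintro _ ⟨R, rfl⟩ _ ⟨R', rfl⟩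
  obtain ⟨a, ha⟩ := left R
  obtain ⟨b, hb⟩ := right R'
  exact (ha.trans (key a b)).trans hb

theorem graphQuery_graphRepresentable (Q : BCQ S X V) (hQ : Q.atoms = Set.range G.atom)
    (hconn : Q.Connected) : G.graphQuery.GraphRepresentable := by
  refine ⟨G.graphQuery_connected Q hQ hconn, ?_, ?_⟩
  · rintro _ ⟨R, rfl⟩ _ ⟨R', rfl⟩ h
    rw [graphAtom_rel, graphAtom_rel] at h
    rw [h]
  · rintro _ ⟨R, rfl⟩
    refine ⟨rfl, ⟨0, rfl⟩, ?_, ?_⟩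
    · intro i
      rcases R with a | p <;> fin_cases i <;> exact ⟨_, rfl⟩
    · intro i j h
      rcases R with a | p <;> fin_cases i <;> fin_cases j <;>
        first
        | rfl
        | exact absurd (Sum.inl.inj h) (G.keyVar_ne_idVar _ _)
        | exact absurd (Sum.inl.inj h).symm (G.keyVar_ne_idVar _ _)
        | exact absurd (Sum.inl.inj h) (G.idVar_ne_posVar _ _)
        | exact absurd (Sum.inl.inj h).symm (G.idVar_ne_posVar _ _)

/-- Valuations are eliminated: tuples come from a valuation exactly when they show the right
constants and agree wherever a variable recurs. -/
theorem certain_iff {W : Type w'} [Nonempty W] (emb : V → W) (Q : BCQ S X V)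
    (hQ : Q.atoms = Set.range G.atom) (I : Database S W) :
    (Q.mapConst emb).Certain I ↔ CertainFamily (fun a => keyPart (G.atom a).rel)
      (fun a => I (G.atom a).rel) (G.Pattern emb) := by
  classical
  have hat : ∀ p ∈ (Q.mapConst emb).atoms, ∃ a, (G.atom a).mapConst emb = p := by
    rintro _ ⟨p, hp, rfl⟩
    rw [hQ] at hp
    obtain ⟨a, rfl⟩ := hp
    exact ⟨a, rfl⟩
  refine (certain_iff_certainFamily (Q.mapConst emb) I (fun a => (G.atom a).mapConst emb)
    G.rel_injective (fun a => ⟨_, hQ ▸ ⟨a, rfl⟩, rfl⟩) fun p hp => Or.inl (hat p hp)).trans ?_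
  refine certainFamily_congr fun f hf => ?_
  constructor
  · rintro ⟨ν, hν, -⟩
    have hval : ∀ p : G.Pos, f p.1 p.2 = Sum.elim ν id (Sum.map id emb (G.term p)) :=
      fun p => congrFun (hν p.1) p.2
    refine ⟨fun p c hp => ?_, ?_⟩
    · rw [hval, hp]
      rfl
    · rintro p p' (rfl | ⟨x, hx, hx'⟩)
      · rfl
      · rw [hval, hval, hx, hx']
  · rintro ⟨hc, hs⟩
    -- The value is read off at any occurrence; variables without an occurrence get an arbitrary
    -- value.
    let ν : X → W := fun x =>
      if h : ∃ p, G.term p = Sum.inl x then f h.choose.1 h.choose.2 else Classical.arbitrary W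
    have hν : ∀ a, f a = ((G.atom a).mapConst emb).tuple ν := by
      refine fun a => funext fun i => ?_
      change f a i = Sum.elim ν id (Sum.map id emb (G.term ⟨a, i⟩))
      rcases hi : G.term ⟨a, i⟩ with x | c
      · have hx : ∃ p, G.term p = Sum.inl x := ⟨_, hi⟩
        simp only [Sum.map_inl, Sum.elim_inl, id, ν, dif_pos hx]
        exact hs ⟨a, i⟩ _ (Or.inr ⟨x, hi, hx.choose_spec⟩)
      · exact hc ⟨a, i⟩ c hi
    refine ⟨ν, hν, fun p hp => ?_⟩
    obtain ⟨a, rfl⟩ := hat p hp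
    rw [← hν a]
    exact hf a

/-- The facts, pairs of a key and a tuple identifier, extend to a match of the graph query. -/
def GraphPattern {W : Type*} (J : Database G.graphSchema W) (f : Fin N → Fin 2 → W) : Prop :=
  ∃ u : G.Pos → W, (∀ p p', G.SameVar p p' → u p = u p') ∧
    (∀ a i, G.keyPos a = some i → u ⟨a, i⟩ = f a 0) ∧ ∀ p, ![f p.1 1, u p] ∈ J (Sum.inr p)

/-- Position relations are of consistent type, so every repair contains them entirely and only the
key-to-identifier relations leave a choice. -/
theorem graphQuery_certain_iff {W : Type w'} (emb : V → W) (J : Database G.graphSchema W)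
    (hJ : IsInstance J) :
    (G.graphQuery.mapConst emb).Certain J ↔
      CertainFamily (fun a : Fin N => keyPart (S := G.graphSchema) (Sum.inl a))
        (fun a => J (Sum.inl a)) (G.GraphPattern J) := by
  have hcov : ∀ p ∈ (G.graphQuery.mapConst emb).atoms,
      (∃ a, (G.graphAtom (Sum.inl a)).mapConst emb = p) ∨ SatisfiesKey J p.rel := by
    rintro _ ⟨_, ⟨a | p, rfl⟩, rfl⟩
    · exact Or.inl ⟨a, rfl⟩
    · refine Or.inr (hJ.2 _ fun a h => ?_)
      cases h
  refine (certain_iff_certainFamily (G.graphQuery.mapConst emb) J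
    (fun a => (G.graphAtom (Sum.inl a)).mapConst emb) (fun a b h => Sum.inl_injective h)
    (fun a => ⟨_, ⟨_, rfl⟩, rfl⟩) hcov).trans ?_
  refine certainFamily_congr fun f hf => ?_
  constructor
  · rintro ⟨ν, hν, hνJ⟩
    refine ⟨fun p => ν (G.posVar p), fun p p' h => ?_, fun a i hi => ?_, fun p => ?_⟩
    · exact congrArg ν (congrArg Sum.inl (Quotient.sound (s := G.posSetoid) h))
    · rw [hν a]
      change _ = ν (G.keyVar a)
      rw [keyVar, hi]
      rfl
    · have := hνJ _ ⟨_, ⟨Sum.inr p, rfl⟩, rfl⟩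
      rw [hν p.1]
      rwa [show ((G.graphAtom (Sum.inr p)).mapConst emb).tuple ν =
        ![ν (G.idVar p.1), ν (G.posVar p)] from
          funext fun (i : Fin 2) => by fin_cases i <;> rfl] at this
  · rintro ⟨u, hu, huk, huJ⟩
    -- The last component serves atoms with `keyPos a = none`: their key column is a mere label and
    -- carries a variable that occurs nowhere else.
    let ν : G.GraphVar → W :=
      Sum.elim (fun c => Quotient.lift (s := G.posSetoid) u hu c)
        (Sum.elim (fun a => f a 1) fun a => f a 0)
    have hν : ∀ a, f a = ((G.graphAtom (Sum.inl a)).mapConst emb).tuple ν := by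
      refine fun a => funext fun (i : Fin 2) => ?_
      fin_cases i
      · change f a 0 = ν (G.keyVar a)
        rw [keyVar]
        rcases hi : G.keyPos a with _ | i
        · rfl
        · exact (huk a i hi).symm
      · rfl
    refine ⟨ν, hν, ?_⟩
    rintro _ ⟨_, ⟨a | p, rfl⟩, rfl⟩
    · rw [← hν a]
      exact hf a
    · rw [show ((G.graphAtom (Sum.inr p)).mapConst emb).tuple ν = ![f p.1 1, u p] from
        funext fun (i : Fin 2) => by fin_cases i <;> rfl]
      exact huJ p

end SimpleKeyFamily

/-! ### Padding, and discarding the irrelevant values of free atoms -/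

/-- A tuple of length at most `k`, padded to a tuple of length `k`. -/
def pad {V : Type w} (k : ℕ) (c : V) {n : ℕ} (s : Fin n → V) : Fin k → V :=
  fun j => if h : j.1 < n then s ⟨j, h⟩ else c

theorem pad_injective {V : Type w} {k : ℕ} (c : V) {n : ℕ} (hn : n ≤ k) :
    Function.Injective (pad k c : (Fin n → V) → _) := by
  intro s t h
  funext i
  have := congrFun h ⟨i, i.2.trans_le hn⟩
  simpa [pad] using this

theorem Expressible.eq_pad {S : Schema.{u}} {V : Type w} {C : Finset V} {α : Type*} {c : V}
    (hc : c ∈ C) {k n : ℕ} (i : α) (g : Fin n → α) (j : Fin k) :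
    Expressible (S := S) C fun _ e => e i = pad k c (fun x => e (g x)) j := by
  unfold pad
  split_ifs with h
  · exact Expressible.eq _ _
  · exact Expressible.eq_const _ hc

namespace SimpleKeyFamily

variable {S : Schema.{u}} {X : Type v} {V : Type w} {N : ℕ} (G : SimpleKeyFamily S X V N)

open Classical in
/-- The position whose value is kept at position `i`: the key position in a free atom, and `i` in
other atoms. -/
noncomputable def keptPos (a : Fin N) (i : Fin (S.arity (G.atom a).rel)) :
    Fin (S.arity (G.atom a).rel) :=
  if h : G.Free a then h.choose else i

theorem keptPos_of_keyPos {a : Fin N} {i : Fin (S.arity (G.atom a).rel)}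
    (h : G.keyPos a = some i) : G.keptPos a i = i := by
  unfold keptPos
  split_ifs with hf
  · exact Option.some.inj (hf.choose_spec.1.symm.trans h)
  · rfl

theorem keptPos_of_not_free {a : Fin N} (h : ¬ G.Free a) (i : Fin (S.arity (G.atom a).rel)) :
    G.keptPos a i = i := by
  simp [keptPos, h]

theorem keptPos_of_free {a : Fin N} (h : G.Free a) {i : Fin (S.arity (G.atom a).rel)}
    (hi : G.keyPos a = some i) (j : Fin (S.arity (G.atom a).rel)) : G.keptPos a j = i := by
  simp only [keptPos, dif_pos h]
  exact Option.some.inj (h.choose_spec.1.symm.trans hi)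

/-- Positions whose value is not kept carry no information. -/
theorem keptPos_ne {a : Fin N} {i : Fin (S.arity (G.atom a).rel)} (h : G.keptPos a i ≠ i) :
    (∀ p, G.SameVar ⟨a, i⟩ p → p = ⟨a, i⟩) ∧ ∃ x, G.term ⟨a, i⟩ = Sum.inl x := by
  have hf : G.Free a := by
    by_contra hf
    exact h (G.keptPos_of_not_free hf i)
  obtain ⟨j, hj, hfree⟩ := id hf
  refine hfree i fun hij => h ?_
  rw [hij]
  exact G.keptPos_of_keyPos hj

/-- The relevant part of a tuple. -/
noncomputable def keep {W : Type*} (a : Fin N) (t : G.Tuple a W) : G.Tuple a W :=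
  fun i => t (G.keptPos a i)

/-- A discarded value sits at a position whose variable has no other occurrence, so no condition of
the pattern involves it. -/
theorem pattern_keep_iff {W : Type*} (emb : V → W) (f : ∀ a, G.Tuple a W) :
    G.Pattern emb (fun a => G.keep a (f a)) ↔ G.Pattern emb f := by
  refine and_congr (forall₃_congr fun p c hp => ?_) (forall₃_congr fun p p' hpp => ?_)
  · by_cases h : G.keptPos p.1 p.2 = p.2
    · simp only [keep, h]
    · obtain ⟨-, x, hx⟩ := G.keptPos_ne h
      exact absurd (hx.symm.trans hp) (by simp)
  · by_cases h : G.keptPos p.1 p.2 = p.2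
    · by_cases h' : G.keptPos p'.1 p'.2 = p'.2
      · simp only [keep, h, h']
      · obtain rfl : p = p' := (G.keptPos_ne h').1 p (G.posSetoid.symm hpp)
        exact iff_of_true rfl rfl
    · obtain rfl : p' = p := (G.keptPos_ne h).1 p' hpp
      exact iff_of_true rfl rfl

/-! ### Reduction to the graph query -/

section Forward

variable (k : ℕ) (c₀ : V)

/-- The code of the key of a tuple. -/
noncomputable def keyCode (a : Fin N) (s : G.Tuple a V) : Fin k → V :=
  (G.keyPos a).elim (pad k c₀ s) fun i _ => s i

/-- The fact of the graph database for a tuple of the relation of the atom `a`. -/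
noncomputable def graphFact (a : Fin N) (t : G.Tuple a V) : Fin 2 → Fin k → V :=
  ![G.keyCode k c₀ a (G.keep a t), pad k c₀ (G.keep a t)]

/-- The tuple has the constants of the atom `a`. -/
def HasConsts {W : Type*} (emb : V → W) (a : Fin N) (s : G.Tuple a W) : Prop :=
  ∀ i c, G.term ⟨a, i⟩ = Sum.inr c → s i = emb c

/-- The graph database of a database. -/
noncomputable def toGraph (I : Database S V) : Database G.graphSchema (Fin k → V)
  | Sum.inl a => G.graphFact k c₀ a '' I (G.atom a).rel
  | Sum.inr p => {t | ∃ s ∈ I (G.atom p.1).rel, G.HasConsts id p.1 (G.keep p.1 s) ∧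
      t = ![pad k c₀ (G.keep p.1 s), fun _ => G.keep p.1 s p.2]}

variable {k c₀}

theorem keyCode_of_some {a : Fin N} {i : Fin (S.arity (G.atom a).rel)}
    (h : G.keyPos a = some i) (s : G.Tuple a V) : G.keyCode k c₀ a s = fun _ => s i := by
  simp [keyCode, h]

theorem keyCode_of_none {a : Fin N} (h : G.keyPos a = none) (s : G.Tuple a V) :
    G.keyCode k c₀ a s = pad k c₀ s := by
  simp [keyCode, h]

theorem keep_of_none {W : Type*} {a : Fin N} (h : G.keyPos a = none) (s : G.Tuple a W) :
    G.keep a s = s := by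
  have hf : ¬ G.Free a := by
    rintro ⟨i, hi, -⟩
    simp [h] at hi
  funext i
  simp [keep, G.keptPos_of_not_free hf]

/-- `keep` fixes the key position, and changes nothing if the key is everything. Positivity of `k`
lets a value be recovered from its constant tuple. -/
theorem graphFact_zero_eq_iff (hk : 0 < k) (hG : ∀ a, S.arity (G.atom a).rel ≤ k) (a : Fin N)
    (s t : G.Tuple a V) : G.graphFact k c₀ a s 0 = G.graphFact k c₀ a t 0 ↔
      keyPart (G.atom a).rel s = keyPart (G.atom a).rel t := by
  rw [keyPart_eq_iff]
  change G.keyCode k c₀ a _ = G.keyCode k c₀ a _ ↔ _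
  rcases h : G.keyPos a with _ | i
  · rw [G.keyCode_of_none h, G.keyCode_of_none h, G.keep_of_none h, G.keep_of_none h,
      (pad_injective c₀ (hG a)).eq_iff, G.key_of_none a h]
    simp [funext_iff]
  · rw [G.keyCode_of_some h, G.keyCode_of_some h, G.key_of_some a i h]
    simp only [keep, G.keptPos_of_keyPos h, Set.mem_singleton_iff, forall_eq]
    exact ⟨fun h' => congrFun h' ⟨0, hk⟩, fun h' => by rw [h']⟩

theorem toGraph_isInstance (hk : 0 < k) (hG : ∀ a, S.arity (G.atom a).rel ≤ k)
    {I : Database S V} (hI : IsInstance I) : IsInstance (G.toGraph k c₀ I) := by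
  constructor
  · rintro (a | p)
    · exact (hI.1 _).image _
    · refine ((hI.1 (G.atom p.1).rel).image fun s =>
        ![pad k c₀ (G.keep p.1 s), fun _ => G.keep p.1 s p.2]).subset ?_
      rintro _ ⟨s, hs, -, rfl⟩
      exact ⟨s, hs, rfl⟩
  · rintro (a | p) hR
    · rintro _ ⟨s, hs, rfl⟩ _ ⟨t, ht, rfl⟩ h
      have hst := (G.graphFact_zero_eq_iff hk hG a s t).1 (h 0 rfl)
      rcases hR a rfl with h' | h' | h'
      · rw [keyPart_eq_iff, G.key_of_none a h'] at hst
        rw [show s = t from funext fun i => hst i trivial]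
      · rw [hI.2 _ h' s hs t ht (keyPart_eq_iff.1 hst)]
      -- In a free atom every kept entry is the key entry, so a block has a single image.
      · obtain ⟨i, hi, -⟩ := id h'
        rw [keyPart_eq_iff, G.key_of_some a i hi] at hst
        have : G.keep a s = G.keep a t := by
          funext j
          simp only [keep, G.keptPos_of_free h' hi]
          exact hst i rfl
        simp only [graphFact, this]
    · rintro _ ⟨s, hs, -, rfl⟩ _ ⟨t, ht, -, rfl⟩ h
      have : G.keep p.1 s = G.keep p.1 t := pad_injective c₀ (hG p.1) (h 0 rfl)
      rw [this]

/-- Padding is injective, so all position facts at the identifier of `f a` carry the kept part of `f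
a`; they exist only if its constants are right. -/
theorem pattern_iff_graphPattern (hk : 0 < k) (hG : ∀ a, S.arity (G.atom a).rel ≤ k)
    (I : Database S V) (f : ∀ a, G.Tuple a V) (hf : ∀ a, f a ∈ I (G.atom a).rel) :
    G.Pattern id f ↔
      G.GraphPattern (G.toGraph k c₀ I) fun a => G.graphFact k c₀ a (f a) := by
  rw [← pattern_keep_iff]
  constructor
  · rintro ⟨hc, hs⟩
    refine ⟨fun p _ => G.keep p.1 (f p.1) p.2, fun p p' h => ?_, fun a i hi => ?_, fun p => ?_⟩
    · simp only [hs p p' h]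
    · exact (G.keyCode_of_some hi _).symm
    · exact ⟨f p.1, hf _, fun i c hi => hc ⟨p.1, i⟩ c hi, rfl⟩
  · rintro ⟨u, hu, -, huP⟩
    have key : ∀ p : G.Pos, G.HasConsts id p.1 (G.keep p.1 (f p.1)) ∧
        u p = fun _ => G.keep p.1 (f p.1) p.2 := by
      intro p
      obtain ⟨s, -, hc, hs⟩ := huP p
      have h0 : pad k c₀ (G.keep p.1 (f p.1)) = pad k c₀ (G.keep p.1 s) := congrFun hs 0
      have h1 : u p = fun _ => G.keep p.1 s p.2 := congrFun hs 1
      rw [pad_injective c₀ (hG p.1) h0]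
      exact ⟨hc, h1⟩
    refine ⟨fun p c hp => (key p).1 _ _ hp, fun p p' h => ?_⟩
    have := hu p p' h
    rw [(key p).2, (key p').2] at this
    exact congrFun this ⟨0, hk⟩

theorem certain_iff_toGraph (hk : 0 < k) (hG : ∀ a, S.arity (G.atom a).rel ≤ k)
    (Q : BCQ S X V) (hQ : Q.atoms = Set.range G.atom) {I : Database S V} (hI : IsInstance I) :
    Q.Certain I ↔
      (G.graphQuery.mapConst fun c (_ : Fin k) => c).Certain (G.toGraph k c₀ I) := by
  have : Nonempty V := ⟨c₀⟩
  rw [G.graphQuery_certain_iff _ _ (G.toGraph_isInstance hk hG hI)]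
  conv_lhs => rw [← Q.mapConst_id]
  rw [G.certain_iff id Q hQ]
  have hkey : ∀ a (s t : G.Tuple a V), keyPart (G.atom a).rel s = keyPart (G.atom a).rel t ↔
      keyPart (S := G.graphSchema) (Sum.inl a) (G.graphFact k c₀ a s) =
        keyPart (S := G.graphSchema) (Sum.inl a) (G.graphFact k c₀ a t) := by
    intro a s t
    rw [← G.graphFact_zero_eq_iff hk hG, keyPart_eq_iff]
    exact ⟨fun h i (hi : i = 0) => hi ▸ h, fun h => h 0 rfl⟩
  refine certainFamily_iff_of_map (G.graphFact k c₀) (fun _ => ∅) (fun a => ?_)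
    (fun a s _ t _ h => (hkey a s t).1 h) (fun a s _ t _ h => Or.inl ((hkey a s t).2 h))
    (fun a s _ t _ _ h => h.elim) (fun f hf => ?_)
  · rw [Set.sdiff_empty]
    rfl
  · rw [G.pattern_iff_graphPattern (c₀ := c₀) hk hG I f hf]
    simp

theorem expressible_toGraph {C : Finset V} (hc₀ : c₀ ∈ C)
    (hC : ∀ p c, G.term p = Sum.inr c → c ∈ C) (R : Fin N ⊕ G.Pos) :
    Expressible C fun I (e : Fin 2 × Fin k → V) => (fun i j => e (i, j)) ∈ G.toGraph k c₀ I R := by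
  rcases R with a | p
  · refine Expressible.congr (P := fun I e => ∃ t : G.Tuple a V, t ∈ I (G.atom a).rel ∧
      (∀ j, e (0, j) = G.keyCode k c₀ a (G.keep a t) j) ∧
      ∀ j, e (1, j) = pad k c₀ (G.keep a t) j) ?_ ?_
    · refine Expressible.exists_tuple ?_ fun I e t ht => mem_activeDomain ht.1
      refine (Expressible.mem _ Sum.inr).and
        ((Expressible.forall_finite fun j => ?_).and (Expressible.forall_finite fun j => ?_))
      · rcases h : G.keyPos a with _ | i
        · simp only [G.keyCode_of_none h]
          exact Expressible.eq_pad hc₀ (Sum.inl (0, j)) (fun i => Sum.inr (G.keptPos a i)) j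
        · simp only [G.keyCode_of_some h]
          exact Expressible.eq (Sum.inl (0, j)) (Sum.inr (G.keptPos a i))
      · exact Expressible.eq_pad hc₀ (Sum.inl (1, j)) (fun i => Sum.inr (G.keptPos a i)) j
    · intro I e _
      refine exists_congr fun t => and_congr_right fun _ => ?_
      constructor
      · rintro ⟨h0, h1⟩
        refine funext fun (i : Fin 2) => funext fun j => ?_
        fin_cases i
        · exact (h0 j).symm
        · exact (h1 j).symm
      · intro h
        exact ⟨fun j => (congrFun (congrFun h 0) j).symm, fun j => (congrFun (congrFun h 1) j).symm⟩
  · refine Expressible.congr (P := fun I e => ∃ t : G.Tuple p.1 V, t ∈ I (G.atom p.1).rel ∧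
      G.HasConsts id p.1 (G.keep p.1 t) ∧ (∀ j, e (0, j) = pad k c₀ (G.keep p.1 t) j) ∧
      ∀ j : Fin k, e (1, j) = G.keep p.1 t p.2) ?_ ?_
    · refine Expressible.exists_tuple ?_ fun I e t ht => mem_activeDomain ht.1
      refine (Expressible.mem _ Sum.inr).and (Expressible.and ?_
        ((Expressible.forall_finite fun j => ?_).and (Expressible.forall_finite fun j => ?_)))
      · refine Expressible.forall_finite fun i => ?_
        rcases h : G.term ⟨p.1, i⟩ with x | c
        · exact (Expressible.const True).congr fun _ _ _ => by simp
        · refine (Expressible.eq_const (Sum.inr (G.keptPos p.1 i)) (hC _ c h)).congr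
            fun I e _ => ?_
          constructor
          · rintro h' _ ⟨rfl⟩
            exact h'
          · exact fun h' => h' c rfl
      · exact Expressible.eq_pad hc₀ (Sum.inl (0, j)) (fun i => Sum.inr (G.keptPos p.1 i)) j
      · exact Expressible.eq (Sum.inl (1, j)) (Sum.inr (G.keptPos p.1 p.2))
    · intro I e _
      refine exists_congr fun t => and_congr_right fun _ => and_congr_right fun _ => ?_
      constructor
      · rintro ⟨h0, h1⟩
        refine funext fun (i : Fin 2) => funext fun j => ?_
        fin_cases i
        · exact h0 j
        · exact h1 j
      · intro h
        exact ⟨fun j => congrFun (congrFun h 0) j, fun j => congrFun (congrFun h 1) j⟩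

theorem toGraph_mem_activeDomain {C : Finset V} (hc₀ : c₀ ∈ C) (I : Database S V)
    (R : Fin N ⊕ G.Pos) : ∀ t ∈ G.toGraph k c₀ I R, ∀ i j, t i j ∈ activeDomain I C := by
  have hkeep : ∀ a, ∀ s ∈ I (G.atom a).rel, ∀ i, G.keep a s i ∈ activeDomain I C :=
    fun a s hs i => mem_activeDomain hs _
  have hpad : ∀ a, ∀ s ∈ I (G.atom a).rel, ∀ j, pad k c₀ (G.keep a s) j ∈ activeDomain I C := by
    intro a s hs j
    unfold pad
    split_ifs
    · exact hkeep a s hs _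
    · exact Or.inl hc₀
  rcases R with a | p
  · rintro _ ⟨s, hs, rfl⟩ (i : Fin 2) j
    fin_cases i
    · change G.keyCode k c₀ a _ j ∈ _
      rcases h : G.keyPos a with _ | i
      · rw [G.keyCode_of_none h]
        exact hpad a s hs j
      · rw [G.keyCode_of_some h]
        exact hkeep a s hs i
    · exact hpad a s hs j
  · rintro _ ⟨s, hs, -, rfl⟩ (i : Fin 2) j
    fin_cases i
    · exact hpad _ s hs j
    · exact hkeep _ s hs _

end Forward

/-! ### Reduction from the graph query -/

/-- The fact `s`, a key with a tuple identifier, describes the tuple `u`. -/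
def Decodes (J : Database G.graphSchema V) (a : Fin N) (s : Fin 2 → V) (u : G.Tuple a V) : Prop :=
  (∀ i, ![s 1, u i] ∈ J (Sum.inr ⟨a, i⟩)) ∧ ∀ i, G.keyPos a = some i → u i = s 0

variable {G} in
-- Position relations are consistent, hence functions of the identifier.
theorem Decodes.unique {J : Database G.graphSchema V} (hJ : IsInstance J) {a : Fin N}
    {s : Fin 2 → V} {u u' : G.Tuple a V} (h : G.Decodes J a s u) (h' : G.Decodes J a s u') :
    u = u' := by
  funext i
  have := hJ.2 (Sum.inr ⟨a, i⟩) (fun b hb => by cases hb) _ (h.1 i) _ (h'.1 i)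
    fun j (hj : j = 0) => by rw [hj]; rfl
  exact congrFun this 1

section Backward

variable (c₀ : V) (b : G.Pos → V)

/-- The tuple that represents `u`, with the constants of the atom `a` at their positions. -/
def tagged (a : Fin N) (u : G.Tuple a V) : G.Tuple a (Fin 2 → V) :=
  fun i => Sum.elim (fun _ => ![u i, c₀]) (fun c _ => c) (G.term ⟨a, i⟩)

open Classical in
/-- A tuple with key `x` whose other values are tags that occur nowhere else. -/
noncomputable def dangling (a : Fin N) (x : V) : G.Tuple a (Fin 2 → V) :=
  fun i => if G.keyPos a = some i then ![x, c₀] else fun _ => b ⟨a, i⟩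

/-- The tuples of the atom `a` in the database described by the graph database `J`. -/
def decoded (J : Database G.graphSchema V) (a : Fin N) : Set (G.Tuple a (Fin 2 → V)) :=
  {t | ∃ s : Fin 2 → V, s ∈ J (Sum.inl a) ∧ ((∃ u, G.Decodes J a s u ∧ t = G.tagged c₀ a u) ∨
    ¬ G.Consistent a ∧ (¬ ∃ u, G.Decodes J a s u) ∧ t = G.dangling c₀ b a (s 0))}

/-- The database described by the graph database `J`. -/
def ofGraph (J : Database G.graphSchema V) : Database S (Fin 2 → V) :=
  fun R => {t | ∃ a, ∃ t' ∈ G.decoded c₀ b J a,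
    (⟨(G.atom a).rel, t'⟩ : (R : S.Rel) × (Fin (S.arity R) → Fin 2 → V)) = ⟨R, t⟩}

open Classical in
/-- The tuple for a fact of the graph database `J`. -/
noncomputable def decode (J : Database G.graphSchema V) (a : Fin N) (s : Fin 2 → V) :
    G.Tuple a (Fin 2 → V) :=
  if h : ∃ u, G.Decodes J a s u then G.tagged c₀ a h.choose else G.dangling c₀ b a (s 0)

/-- The facts of the graph database `J` that describe no tuple and are left out. -/
def dropped (J : Database G.graphSchema V) (a : Fin N) : Set (Fin 2 → V) :=
  {s | G.Consistent a ∧ ¬ ∃ u, G.Decodes J a s u}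

variable {c₀ b}

theorem tagged_of_var {a : Fin N} {i : Fin (S.arity (G.atom a).rel)} {x : X}
    (h : G.term ⟨a, i⟩ = Sum.inl x) (u : G.Tuple a V) : G.tagged c₀ a u i = ![u i, c₀] := by
  simp [tagged, h]

theorem tagged_of_const {a : Fin N} {i : Fin (S.arity (G.atom a).rel)} {c : V}
    (h : G.term ⟨a, i⟩ = Sum.inr c) (u : G.Tuple a V) : G.tagged c₀ a u i = fun _ => c := by
  simp [tagged, h]

theorem decode_of_decodes {J : Database G.graphSchema V} (hJ : IsInstance J) {a : Fin N}
    {s : Fin 2 → V} {u : G.Tuple a V} (h : G.Decodes J a s u) :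
    G.decode c₀ b J a s = G.tagged c₀ a u := by
  have h' : ∃ u, G.Decodes J a s u := ⟨u, h⟩
  rw [decode, dif_pos h', h'.choose_spec.unique hJ h]

theorem decode_of_not {J : Database G.graphSchema V} {a : Fin N} {s : Fin 2 → V}
    (h : ¬ ∃ u, G.Decodes J a s u) : G.decode c₀ b J a s = G.dangling c₀ b a (s 0) := by
  rw [decode, dif_neg h]

/-- Here the key attribute must hold a variable: `tagged` would overwrite the key value by a
constant, and blocks would be lost. -/
theorem decode_keyPos {J : Database G.graphSchema V} (hJ : IsInstance J) {a : Fin N}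
    {i : Fin (S.arity (G.atom a).rel)} (hi : G.keyPos a = some i) (s : Fin 2 → V) :
    G.decode c₀ b J a s i = ![s 0, c₀] := by
  by_cases h : ∃ u, G.Decodes J a s u
  · obtain ⟨u, hu⟩ := h
    obtain ⟨x, hx⟩ := G.var_of_some a i hi
    rw [G.decode_of_decodes hJ hu, G.tagged_of_var hx, hu.2 i hi]
  · rw [G.decode_of_not h, dangling, if_pos hi]

theorem decoded_eq {J : Database G.graphSchema V} (hJ : IsInstance J) (a : Fin N) :
    G.decoded c₀ b J a = G.decode c₀ b J a '' (J (Sum.inl a) \ G.dropped J a) := by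
  ext t
  constructor
  · rintro ⟨s, hs, ⟨u, hu, rfl⟩ | ⟨hc, hno, rfl⟩⟩
    · exact ⟨s, ⟨hs, fun h => h.2 ⟨u, hu⟩⟩, G.decode_of_decodes hJ hu⟩
    · exact ⟨s, ⟨hs, fun h => hc h.1⟩, G.decode_of_not hno⟩
  · rintro ⟨s, ⟨hs, hD⟩, rfl⟩
    refine ⟨s, hs, ?_⟩
    by_cases h : ∃ u, G.Decodes J a s u
    · obtain ⟨u, hu⟩ := h
      exact Or.inl ⟨u, hu, G.decode_of_decodes hJ hu⟩
    · exact Or.inr ⟨fun hc => hD ⟨hc, h⟩, h, G.decode_of_not h⟩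

theorem ofGraph_rel (J : Database G.graphSchema V) (a : Fin N) :
    G.ofGraph c₀ b J (G.atom a).rel = G.decoded c₀ b J a := by
  ext t
  constructor
  · rintro ⟨a', t', ht', h⟩
    obtain rfl : a' = a := G.rel_injective (congrArg Sigma.fst h)
    simp only [Sigma.mk.injEq, heq_eq_eq, true_and] at h
    exact h ▸ ht'
  · exact fun ht => ⟨a, t, ht, rfl⟩

theorem ofGraph_of_ne (J : Database G.graphSchema V) {R : S.Rel} (hR : ∀ a, (G.atom a).rel ≠ R) :
    G.ofGraph c₀ b J R = ∅ := by
  ext t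
  simp only [Set.mem_empty_iff_false, iff_false]
  rintro ⟨a, t', -, h⟩
  exact hR a (congrArg Sigma.fst h)

theorem eq_of_consistent {J : Database G.graphSchema V} (hJ : IsInstance J) {a : Fin N}
    (ha : G.Consistent a) {s t : Fin 2 → V} (hs : s ∈ J (Sum.inl a)) (ht : t ∈ J (Sum.inl a))
    (h : s 0 = t 0) : s = t :=
  hJ.2 (Sum.inl a) (fun _ hb => Sum.inl_injective hb ▸ ha) s hs t ht
    fun i (hi : i = 0) => hi ▸ h

theorem ofGraph_isInstance {J : Database G.graphSchema V} (hJ : IsInstance J) :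
    IsInstance (G.ofGraph c₀ b J) := by
  constructor
  · intro R
    by_cases hR : ∃ a, (G.atom a).rel = R
    · obtain ⟨a, rfl⟩ := hR
      rw [G.ofGraph_rel, G.decoded_eq hJ]
      exact ((hJ.1 _).subset Set.sdiff_subset).image _
    · rw [G.ofGraph_of_ne J (not_exists.1 hR)]
      exact Set.finite_empty
  · intro R hRc
    by_cases hR : ∃ a, (G.atom a).rel = R
    · obtain ⟨a, rfl⟩ := hR
      rw [SatisfiesKey, G.ofGraph_rel, G.decoded_eq hJ]
      rintro _ ⟨s, hs, rfl⟩ _ ⟨t, ht, rfl⟩ h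
      rcases hi : G.keyPos a with _ | i
      · rw [G.key_of_none a hi] at h
        exact funext fun i => h i trivial
      · have := h i (G.key_of_some a i hi ▸ rfl)
        rw [G.decode_keyPos hJ hi, G.decode_keyPos hJ hi] at this
        rw [G.eq_of_consistent hJ (Or.inr (Or.inl hRc)) hs.1 ht.1 (congrFun this 0)]
    · intro s hs
      rw [G.ofGraph_of_ne J (not_exists.1 hR)] at hs
      exact hs.elim

/-- At variable positions, values are pairs ending in `c₀`, whereas a tag is `(b p, b p)` with `b p
≠ c₀`. Hence a tag equals neither an ordinary value, nor a constant of the query, nor the tag of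
another position, and a dangling tuple can match only if its atom is free. -/
theorem graphPattern_iff_pattern {J : Database G.graphSchema V} (hJ : IsInstance J)
    (hb : Function.Injective b) (hb₀ : ∀ p, b p ≠ c₀)
    (hbc : ∀ p p' c, G.term p = Sum.inr c → b p' ≠ c) (f : Fin N → Fin 2 → V) :
    G.GraphPattern J f ↔ (∀ a, f a ∉ G.dropped J a) ∧
      G.Pattern (fun c _ => c) fun a => G.decode c₀ b J a (f a) := by
  constructor
  · rintro ⟨u, hu, huk, huP⟩
    have hdec : ∀ a, G.Decodes J a (f a) fun i => u ⟨a, i⟩ :=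
      fun a => ⟨fun i => huP ⟨a, i⟩, huk a⟩
    refine ⟨fun a h => h.2 ⟨_, hdec a⟩, fun p c hp => ?_, ?_⟩
    · change G.decode c₀ b J p.1 (f p.1) p.2 = _
      rw [G.decode_of_decodes hJ (hdec p.1), G.tagged_of_const hp]
    · rintro p p' (rfl | ⟨x, hx, hx'⟩)
      · rfl
      · change G.decode c₀ b J p.1 (f p.1) p.2 = G.decode c₀ b J p'.1 (f p'.1) p'.2
        rw [G.decode_of_decodes hJ (hdec p.1), G.decode_of_decodes hJ (hdec p'.1),
          G.tagged_of_var hx, G.tagged_of_var hx', hu p p' (Or.inr ⟨x, hx, hx'⟩)]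
  · rintro ⟨hD, hc, hs⟩
    have hdec : ∀ a, ∃ u, G.Decodes J a (f a) u := by
      intro a
      by_contra ha
      have hcons : ¬ G.Consistent a := fun h => hD a ⟨h, ha⟩
      obtain ⟨i, hi⟩ := Option.ne_none_iff_exists'.1 fun h => hcons (Or.inl h)
      -- A matching dangling tuple would make the atom free, hence consistent, and its fact would
      -- have been dropped.
      refine hcons (Or.inr (Or.inr ⟨i, hi, fun j hj => ?_⟩))
      have hval : G.decode c₀ b J a (f a) j = fun _ => b ⟨a, j⟩ := by
        rw [G.decode_of_not ha, dangling, if_neg]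
        rw [hi]
        exact fun h => hj (Option.some.inj h).symm
      constructor
      · intro p hp
        have hpv : G.decode c₀ b J p.1 (f p.1) p.2 = fun _ => b ⟨a, j⟩ :=
          (hs _ _ hp).symm.trans hval
        rcases hp with rfl | ⟨x, -, hx⟩
        · rfl
        · by_cases hpu : ∃ u, G.Decodes J p.1 (f p.1) u
          · obtain ⟨u, hu⟩ := hpu
            rw [G.decode_of_decodes hJ hu, G.tagged_of_var hx] at hpv
            exact absurd (congrFun hpv 1).symm (hb₀ _)
          · rw [G.decode_of_not hpu, dangling] at hpv
            split_ifs at hpv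
            · exact absurd (congrFun hpv 1).symm (hb₀ _)
            · exact hb (congrFun hpv 0)
      · rcases hj' : G.term ⟨a, j⟩ with x | c
        · exact ⟨x, rfl⟩
        · have := hc ⟨a, j⟩ c hj'
          exact absurd (congrFun (hval.symm.trans this) 0) (hbc _ _ c hj')
    choose u hu using hdec
    refine ⟨fun p => u p.1 p.2, ?_, fun a => (hu a).2, fun p => (hu p.1).1 p.2⟩
    rintro p p' (rfl | ⟨x, hx, hx'⟩)
    · rfl
    · have : G.decode c₀ b J p.1 (f p.1) p.2 = G.decode c₀ b J p'.1 (f p'.1) p'.2 :=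
        hs p p' (Or.inr ⟨x, hx, hx'⟩)
      rw [G.decode_of_decodes hJ (hu p.1), G.decode_of_decodes hJ (hu p'.1)] at this
      exact congrFun ((G.tagged_of_var hx _).symm.trans (this.trans (G.tagged_of_var hx' _))) 0

theorem certain_iff_ofGraph {J : Database G.graphSchema V} (hJ : IsInstance J)
    (hb : Function.Injective b) (hb₀ : ∀ p, b p ≠ c₀)
    (hbc : ∀ p p' c, G.term p = Sum.inr c → b p' ≠ c)
    (Q : BCQ S X V) (hQ : Q.atoms = Set.range G.atom) :
    G.graphQuery.Certain J ↔
      (Q.mapConst fun c (_ : Fin 2) => c).Certain (G.ofGraph c₀ b J) := by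
  have : Nonempty V := ⟨c₀⟩
  rw [G.certain_iff _ Q hQ]
  conv_lhs => rw [← G.graphQuery.mapConst_id]
  rw [G.graphQuery_certain_iff id J hJ]
  have hkey : ∀ a (s t : Fin 2 → V), keyPart (S := G.graphSchema) (Sum.inl a) s =
      keyPart (S := G.graphSchema) (Sum.inl a) t ↔ s 0 = t 0 := by
    intro a s t
    rw [keyPart_eq_iff]
    exact ⟨fun h => h 0 rfl, fun h i (hi : i = 0) => hi ▸ h⟩
  refine certainFamily_iff_of_map (G.decode c₀ b J) (G.dropped J) (fun a => ?_)
    (fun a s hs t ht h => ?_) (fun a s hs t ht h => ?_) (fun a s hs t ht h hsD => ?_)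
    (fun f _ => G.graphPattern_iff_pattern hJ hb hb₀ hbc f)
  · rw [G.ofGraph_rel, G.decoded_eq hJ]
  · rcases hi : G.keyPos a with _ | i
    · rw [G.eq_of_consistent hJ (Or.inl hi) hs.1 ht.1 ((hkey a s t).1 h)]
    · rw [keyPart_eq_iff, G.key_of_some a i hi]
      rintro _ rfl
      rw [G.decode_keyPos hJ hi, G.decode_keyPos hJ hi, (hkey a s t).1 h]
  · rw [keyPart_eq_iff] at h
    rcases hi : G.keyPos a with _ | i
    · rw [G.key_of_none a hi] at h
      -- Different keys of the graph relation may lead to the same tuple here.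
      exact Or.inr (funext fun i => h i trivial)
    · have := h i (G.key_of_some a i hi ▸ rfl)
      rw [G.decode_keyPos hJ hi, G.decode_keyPos hJ hi] at this
      exact Or.inl ((hkey a s t).2 (congrFun this 0))
  -- Blocks of a consistent relation are single facts, so whole blocks are dropped.
  · exact G.eq_of_consistent hJ hsD.1 hs ht ((hkey a s t).1 h) ▸ hsD

theorem expressible_decodes {C : Finset V} {α : Type*} (a : Fin N) (s : Fin 2 → α)
    (u : Fin (S.arity (G.atom a).rel) → α) :
    Expressible C fun J e => G.Decodes J a (fun i => e (s i)) fun i => e (u i) := by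
  refine (Expressible.forall_finite fun i => ?_).and
    (Expressible.forall_finite fun i => Expressible.imp_const _ fun _ => Expressible.eq _ _)
  refine (Expressible.mem (S := G.graphSchema) (Sum.inr ⟨a, i⟩) ![s 1, u i]).congr
    fun J e _ => ?_
  rw [show (fun j : Fin 2 => e (![s 1, u i] j)) = ![e (s 1), e (u i)] from
    funext fun j => by fin_cases j <;> rfl]

theorem Decodes.mem_activeDomain {G : SimpleKeyFamily S X V N} {J : Database G.graphSchema V}
    {a : Fin N} {s : Fin 2 → V} {u : G.Tuple a V} (h : G.Decodes J a s u) (C : Finset V)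
    (i : Fin (S.arity (G.atom a).rel)) : u i ∈ activeDomain J C :=
  CQA.mem_activeDomain (S := G.graphSchema) (h.1 i) 1

theorem expressible_ofGraph {C : Finset V} (hc₀ : c₀ ∈ C)
    (hC : ∀ p c, G.term p = Sum.inr c → c ∈ C) (hbC : ∀ p, b p ∈ C) (R : S.Rel) :
    Expressible C fun J (e : Fin (S.arity R) × Fin 2 → V) =>
      (fun i j => e (i, j)) ∈ G.ofGraph c₀ b J R := by
  by_cases hR : ∃ a, (G.atom a).rel = R
  swap
  · simp only [G.ofGraph_of_ne _ (not_exists.1 hR), Set.mem_empty_iff_false]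
    exact Expressible.const False
  obtain ⟨a, rfl⟩ := hR
  simp only [G.ofGraph_rel]
  refine Expressible.exists_tuple (β := Fin 2) ?_ fun J e s hs =>
    mem_activeDomain (S := G.graphSchema) (R := Sum.inl a) hs.1
  refine (Expressible.mem (S := G.graphSchema) (Sum.inl a) Sum.inr).and (Expressible.or ?_
    (Expressible.and (Expressible.const _) (Expressible.and (Expressible.not ?_) ?_)))
  · refine Expressible.exists_tuple
      (P := fun J e u => G.Decodes J a (fun i => e (Sum.inr i)) u ∧
        (fun i j => e (Sum.inl (i, j))) = G.tagged c₀ a u) ?_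
      fun J e u hu => hu.1.mem_activeDomain C
    refine (G.expressible_decodes a (fun i => Sum.inl (Sum.inr i)) Sum.inr).and ?_
    refine (Expressible.forall_finite (ι := Fin (S.arity (G.atom a).rel))
      (P := fun i _ e => (fun j => e (Sum.inl (Sum.inl (i, j)))) =
        G.tagged c₀ a (e ∘ Sum.inr) i) fun i => ?_).congr fun J e _ => funext_iff.symm
    rcases h : G.term ⟨a, i⟩ with x | c
    · simp only [G.tagged_of_var h]
      refine ((Expressible.eq (Sum.inl (Sum.inl (i, 0))) (Sum.inr i)).and
        (Expressible.eq_const (Sum.inl (Sum.inl (i, 1))) hc₀)).congr fun J e _ => ?_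
      simp [funext_iff, Fin.forall_fin_two]
    · simp only [G.tagged_of_const h]
      exact (Expressible.forall_finite fun j => Expressible.eq_const (Sum.inl (Sum.inl (i, j)))
        (hC _ c h)).congr fun J e _ => funext_iff.symm
  · refine Expressible.exists_tuple
      (P := fun J e u => G.Decodes J a (fun i => e (Sum.inr i)) u) ?_
      fun J e u hu => hu.mem_activeDomain C
    exact G.expressible_decodes a (fun i => Sum.inl (Sum.inr i)) Sum.inr
  · refine (Expressible.forall_finite (ι := Fin (S.arity (G.atom a).rel))
      (P := fun i _ e => (fun j => e (Sum.inl (i, j))) =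
        G.dangling c₀ b a (e (Sum.inr 0)) i) fun i => ?_).congr fun J e _ => funext_iff.symm
    unfold dangling
    split_ifs with h
    · refine ((Expressible.eq (Sum.inl (i, 0)) (Sum.inr 0)).and
        (Expressible.eq_const (Sum.inl (i, 1)) hc₀)).congr fun J e _ => ?_
      simp [funext_iff, Fin.forall_fin_two]
    · exact (Expressible.forall_finite fun j => Expressible.eq_const (Sum.inl (i, j))
        (hbC _)).congr fun J e _ => funext_iff.symm

theorem ofGraph_mem_activeDomain {C : Finset V} (hc₀ : c₀ ∈ C)
    (hC : ∀ p c, G.term p = Sum.inr c → c ∈ C) (hbC : ∀ p, b p ∈ C)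
    (J : Database G.graphSchema V) (R : S.Rel) :
    ∀ t ∈ G.ofGraph c₀ b J R, ∀ i j, t i j ∈ activeDomain J C := by
  rintro t ⟨a, t', ht', h⟩
  obtain rfl := congrArg Sigma.fst h
  simp only [Sigma.mk.injEq, heq_eq_eq, true_and] at h
  subst h
  obtain ⟨s, hs, ⟨u, hu, rfl⟩ | ⟨-, -, rfl⟩⟩ := ht'
  · intro i j
    rcases h : G.term ⟨a, i⟩ with x | c
    · rw [G.tagged_of_var h]
      fin_cases j
      · exact hu.mem_activeDomain C i
      · exact Or.inl hc₀
    · rw [G.tagged_of_const h]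
      exact Or.inl (hC _ c h)
  · intro i j
    unfold dangling
    split_ifs
    · fin_cases j
      · exact mem_activeDomain (S := G.graphSchema) (R := Sum.inl a) hs 0
      · exact Or.inl hc₀
    · exact Or.inl (hbC _)

end Backward

/-! ### Assembly -/

theorem foInterReducible_graphQuery [Infinite V] (Q : BCQ S X V)
    (hQ : Q.atoms = Set.range G.atom) : FOInterReducible Q G.graphQuery := by
  classical
  let c₀ : V := Classical.arbitrary V
  have hfin : (insert c₀ {c | ∃ p, G.term p = Sum.inr c}).Finite := by
    refine Set.Finite.insert _ ((Set.finite_range fun p => Sum.elim (fun _ => c₀) id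
      (G.term p)).subset ?_)
    rintro c ⟨p, hp⟩
    exact ⟨p, by simp [hp]⟩
  -- Infinity of `V` provides a separate tag for each position, away from `c₀` and the constants of
  -- the query.
  obtain ⟨b, hb⟩ : ∃ b : G.Pos → V, Function.Injective b ∧ ∀ p, b p ∉ hfin.toFinset := by
    let e := hfin.infinite_compl.natEmbedding
    obtain ⟨n, ⟨g⟩⟩ := Finite.exists_equiv_fin G.Pos
    exact ⟨fun p => e (g p), fun p p' h => g.injective (Fin.ext (e.injective (Subtype.ext h))),
      fun p => by simpa using (e (g p)).2⟩
  let C : Finset V := hfin.toFinset ∪ Finset.univ.image b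
  have hc₀ : c₀ ∈ C := by simp [C]
  have hC : ∀ p c, G.term p = Sum.inr c → c ∈ C := by
    intro p c hp
    refine Finset.mem_union_left _ (hfin.mem_toFinset.2 (Or.inr ⟨p, hp⟩))
  have hbC : ∀ p, b p ∈ C := fun p => by simp [C]
  have hb₀ : ∀ p, b p ≠ c₀ := fun p h => hb.2 p (by simp [h])
  have hbc : ∀ p p' c, G.term p = Sum.inr c → b p' ≠ c := fun p p' c hp h =>
    hb.2 p' (hfin.mem_toFinset.2 (Or.inr ⟨p, h ▸ hp⟩))
  -- The summand 1 keeps `k` positive when all atoms are nullary.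
  let k := (Finset.univ.sup fun a => S.arity (G.atom a).rel) + 1
  have hk : 0 < k := Nat.succ_pos _
  have hG : ∀ a, S.arity (G.atom a).rel ≤ k := fun a =>
    (Finset.le_sup (f := fun a => S.arity (G.atom a).rel) (Finset.mem_univ a)).trans
      (Nat.le_succ _)
  exact ⟨foReducible_of_expressible hk C (G.toGraph k c₀)
      (G.toGraph_mem_activeDomain hc₀) (G.expressible_toGraph hc₀ hC)
      fun I hI => ⟨G.toGraph_isInstance hk hG hI, G.certain_iff_toGraph hk hG Q hQ hI⟩,
    foReducible_of_expressible two_pos C (G.ofGraph c₀ b)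
      (G.ofGraph_mem_activeDomain hc₀ hC hbC) (G.expressible_ofGraph hc₀ hC hbC)
      fun J hJ => ⟨G.ofGraph_isInstance hJ, G.certain_iff_ofGraph hJ hb.1 hb₀ hbc Q hQ⟩⟩

end SimpleKeyFamily

theorem exists_simpleKeyFamily {S : Schema.{u}} {X : Type v} {V : Type w} (Q : BCQ S X V)
    (hsjf : Q.SelfJoinFree)
    (hkey : ∀ a ∈ Q.atoms, (∃ i, S.key a.rel = {i}) ∨ S.key a.rel = Set.univ)
    (hkeyvar : ∀ a ∈ Q.atoms, S.key a.rel ≠ Set.univ →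
      ∀ i ∈ S.key a.rel, ∃ x, a.args i = Sum.inl x) :
    ∃ (N : ℕ) (G : SimpleKeyFamily S X V N), Q.atoms = Set.range G.atom := by
  have := Q.finite_atoms.to_subtype
  obtain ⟨N, ⟨e⟩⟩ := Finite.exists_equiv_fin Q.atoms
  have h : ∀ a : Q.atoms, ∃ o : Option (Fin (S.arity a.1.rel)),
      (o = none → S.key a.1.rel = Set.univ) ∧ (∀ i, o = some i → S.key a.1.rel = {i}) ∧
        ∀ i, o = some i → ∃ x, a.1.args i = Sum.inl x := by
    rintro ⟨a, ha⟩
    -- The full key is tested first: the one attribute of a unary relation may hold a constant,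
    -- since `hkeyvar` says nothing about it.
    by_cases hu : S.key a.rel = Set.univ
    · exact ⟨none, fun _ => hu, by simp, by simp⟩
    · obtain ⟨i, hi⟩ := (hkey a ha).resolve_right hu
      refine ⟨some i, by simp, ?_, ?_⟩
      · rintro _ ⟨rfl⟩
        exact hi
      · rintro _ ⟨rfl⟩
        exact hkeyvar a ha hu i (hi ▸ rfl)
  choose o h1 h2 h3 using h
  refine ⟨N, ⟨fun a => e.symm a, fun a b hab => ?_, fun a => o (e.symm a), fun a => h1 _,
    fun a => h2 _, fun a => h3 _⟩, ?_⟩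
  · exact e.symm.injective (Subtype.ext (hsjf (e.symm a).2 (e.symm b).2 hab))
  · ext a
    exact ⟨fun ha => ⟨e ⟨a, ha⟩, by simp⟩, by rintro ⟨i, rfl⟩; exact (e.symm i).2⟩

end CQA

theorem mainTheorem9 {V : Type*} [Infinite V] {S : CQA.Schema} {X : Type*} (Q : CQA.BCQ S X V)
    (hconn : Q.Connected) (hsjf : Q.SelfJoinFree)
    (hkey : ∀ a ∈ Q.atoms, (∃ i, S.key a.rel = {i}) ∨ S.key a.rel = Set.univ)
    (hkeyvar : ∀ a ∈ Q.atoms, S.key a.rel ≠ Set.univ →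
      ∀ i ∈ S.key a.rel, ∃ x, a.args i = Sum.inl x) :
    ∃ (S' : CQA.Schema.{0}) (X' : Type) (Q' : CQA.BCQ S' X' V),
      Q'.GraphRepresentable ∧ CQA.FOInterReducible Q Q' := by
  obtain ⟨N, G, hQ⟩ := CQA.exists_simpleKeyFamily Q hsjf hkey hkeyvar
  exact ⟨G.graphSchema, G.GraphVar, G.graphQuery,
    G.graphQuery_graphRepresentable Q hQ hconn, G.foInterReducible_graphQuery Q hQ⟩
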